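/- Let $\mathcal P\subset\mathbb R^N$ be an integral convex polytope, i.e. a convex polytope all of whose vertices lie in $\mathbb Z^N$. Let $\widetilde{\mathcal P}\subset\mathbb R^{N+1}$ be the convex hull of the points $(\alpha,1)$, $\alpha\in\mathcal P$, and let $\mathcal A_{\mathcal P}=\widetilde{\mathcal P}\cap\mathbb Z^{N+1}$. Write $\mathbb R_{\ge0}\mathcal A_{\mathcal P}$, $\mathbb Z\mathcal A_{\mathcal P}$ and $\mathbb Z_{\ge0}\mathcal A_{\mathcal P}$ for the sets of all finite linear combinations of elements of $\mathcal A_{\mathcal P}$ with nonnegative real, integer, and nonnegative integer coefficients, respectively. The elements of $(\mathbb R_{\ge0}\mathcal A_{\mathcal P}\cap\mathbb Z\mathcal A_{\mathcal P})\setminus\mathbb Z_{\ge0}\mathcal A_{\mathcal P}$ are called the holes of $\mathcal P$. The polytope $\mathcal P$ is called normal if $\mathbb R_{\ge0}\mathcal A_{\mathcal P}\cap\mathbb Z\mathcal A_{\mathcal P}=\mathbb Z_{\ge0}\mathcal A_{\mathcal P}$, and very ample if its set of holes is finite. **Theorem.** Let $h$ and $d$ be integers with $h\ge1$ and $d\ge3$.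 Then there exists a non-normal very ample integral convex polytope of dimension $d$ which has exactly $h$ holes. More precisely, let $\mathbf e_1,\dots,\mathbf e_d$ be the unit coordinate vectors of $\mathbb R^d$, let $\mathbf s=\mathbf e_2+\cdots+\mathbf e_{d-1}$, and let $\mathcal P_{h,d}\subset\mathbb R^d$ be the convex hull of the points $$\mathbf 0,\quad \mathbf e_d,\quad \mathbf s,\quad h(\mathbf s+\mathbf e_d),\quad (h-1)\mathbf s+h\mathbf e_d,\quad h\mathbf s+(h-1)\mathbf e_d,$$ $$\mathbf e_1+4\mathbf e_d,\quad \mathbf e_1+5\mathbf e_d,\quad \mathbf e_1+\mathbf s,\quad \mathbf e_1+\mathbf s+\mathbf e_d,$$ together with the points $\mathbf e_i$ and $\mathbf e_i+\mathbf e_d$ for $i=2,\dots,d-1$. Then $\mathcal P_{h,d}$ is an integral convex polytope of dimension $d$ that is very ample but not normal, and it has exactly $h$ holes. -/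

import Mathlib

open scoped NNReal

noncomputable section

namespace LatticePolytope

/-- The lattice `ℤ ^ n`, as a subset of `ℝ ^ n`. -/
def integerPoints (n : ℕ) : Set (Fin n → ℝ) :=
  {x | ∀ i, ∃ m : ℤ, x i = (m : ℝ)}

/-- An integral convex polytope in `ℝ ^ n`: the convex hull of a finite set of points,
all of whose vertices (extreme points) belong to `ℤ ^ n`. -/
def IsIntegralConvexPolytope {n : ℕ} (P : Set (Fin n → ℝ)) : Prop :=
  (∃ S : Set (Fin n → ℝ), S.Finite ∧ P = convexHull ℝ S) ∧
    Set.extremePoints ℝ P ⊆ integerPoints n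

/-- The dimension of `P`: the dimension of its affine hull. -/
def dim {n : ℕ} (P : Set (Fin n → ℝ)) : ℕ :=
  Module.finrank ℝ (vectorSpan ℝ P)

/-- The convex hull in `ℝ ^ (n + 1)` of the points `(α, 1)` with `α ∈ P`. -/
def homogenization {n : ℕ} (P : Set (Fin n → ℝ)) : Set (Fin (n + 1) → ℝ) :=
  convexHull ℝ ((fun α : Fin n → ℝ => (Fin.snoc α (1 : ℝ) : Fin (n + 1) → ℝ)) '' P)

/-- `A_P`: the integer points of the homogenization of `P`. -/
def latticeGens {n : ℕ} (P : Set (Fin n → ℝ)) : Set (Fin (n + 1) → ℝ) :=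
  homogenization P ∩ integerPoints (n + 1)

/-- `ℝ≥0 A_P`: all finite nonnegative real combinations of points of `A_P`. -/
def cone {n : ℕ} (P : Set (Fin n → ℝ)) : Set (Fin (n + 1) → ℝ) :=
  (Submodule.span ℝ≥0 (latticeGens P) : Set (Fin (n + 1) → ℝ))

/-- `ℤ A_P`: all finite integer combinations of points of `A_P`. -/
def lattice {n : ℕ} (P : Set (Fin n → ℝ)) : Set (Fin (n + 1) → ℝ) :=
  (AddSubgroup.closure (latticeGens P) : Set (Fin (n + 1) → ℝ))

/-- `ℤ≥0 A_P`: all finite nonnegative integer combinations of points of `A_P`. -/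
def semigroup {n : ℕ} (P : Set (Fin n → ℝ)) : Set (Fin (n + 1) → ℝ) :=
  (AddSubmonoid.closure (latticeGens P) : Set (Fin (n + 1) → ℝ))

/-- The holes of `P`. -/
def holes {n : ℕ} (P : Set (Fin n → ℝ)) : Set (Fin (n + 1) → ℝ) :=
  (cone P ∩ lattice P) \ semigroup P

/-- `P` is normal. -/
def IsNormal {n : ℕ} (P : Set (Fin n → ℝ)) : Prop :=
  cone P ∩ lattice P = semigroup P

/-- `P` is very ample. -/
def IsVeryAmple {n : ℕ} (P : Set (Fin n → ℝ)) : Prop :=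
  (holes P).Finite

/-- The unit coordinate vector `e_i` of `ℝ ^ d`, with `i` running through `1, …, d`. -/
def e (d i : ℕ) : Fin d → ℝ :=
  fun j => if (j : ℕ) + 1 = i then 1 else 0

/-- The vector `e_2 + ⋯ + e_{d-1}` of `ℝ ^ d`. -/
def s (d : ℕ) : Fin d → ℝ :=
  ∑ i ∈ Finset.Icc 2 (d - 1), e d i

/-- The points `u_1, …, u_10`. -/
def uPoints (h d : ℕ) : Set (Fin d → ℝ) :=
  { 0,
    e d d,
    s d,
    (h : ℝ) • (s d + e d d),
    ((h : ℝ) - 1) • s d + (h : ℝ) • e d d,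
    (h : ℝ) • s d + ((h : ℝ) - 1) • e d d,
    e d 1 + (4 : ℝ) • e d d,
    e d 1 + (5 : ℝ) • e d d,
    e d 1 + s d,
    e d 1 + s d + e d d }

/-- The points `v_i = e_i` and `v_i' = e_i + e_d`, for `i = 2, …, d - 1`. -/
def vPoints (d : ℕ) : Set (Fin d → ℝ) :=
  {x | ∃ i ∈ Finset.Icc 2 (d - 1), x = e d i ∨ x = e d i + e d d}

/-- The polytope `P_{h,d}`. -/
def polytopeP (h d : ℕ) : Set (Fin d → ℝ) :=
  convexHull ℝ (uPoints h d ∪ vPoints d)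

end LatticePolytope

end

namespace LatticePolytope

/-! Write points as `(a, y, z)`, with `k` for the degree. The polytope is spanned by a parallelogram
in `a = 1`, a strip `|z - c| ≤ 1` along the diagonal `y = (c, …, c)` in `a = 0`, and the segments
`[e_i, e_i + e_d]`.

For an integer point of the cone put `c = min y`. The segments carry the excess `D = ∑ (y i - c)`,
which leaves degree `b = k - a - D` for the strip (`inCone_int`). Once `c = p + q` is split between
parallelogram and strip, the attainable last coordinates form an interval that descends as `p`
grows. Consecutive intervals miss no integer in between, except when `a = b = 1`: there `p = 1` ends
at `c + 1` and `p = 0` starts at `c + 3`. The skipped value `z = c + 2`, for `1 ≤ c ≤ h`, is a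
genuine obstruction only if `D = 0`, since otherwise the segments bridge the gap
(`exists_facet_coordinate`, `exists_decomposition`). Every other integer point of the cone splits
into integer pieces that are sums of generators, so there are at most `h` holes.

Conversely, each of these `h` points is a half-sum of four generators and an integer combination of
generators, and the same gap keeps it from being a sum of two degree-one lattice points
(`holePoint_notMem_semigroup`).

A complete list of `A_P` is never needed: it is enough that the generators belong to it and that all
of it satisfies `InCone`. -/

/-- The point of `ℝ ^ (m + 2)` with first coordinate `a`, middle coordinates `y` and
last coordinate `z`. -/
def pt {m : ℕ} (a : ℝ) (y : Fin m → ℝ) (z : ℝ) : Fin (m + 2) → ℝ :=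
  Fin.snoc (α := fun _ => ℝ) (Fin.cons a y : Fin (m + 1) → ℝ) z

/-- The point `pt a y z` with the degree `k` appended. -/
def hpt {m : ℕ} (a : ℝ) (y : Fin m → ℝ) (z k : ℝ) : Fin (m + 2 + 1) → ℝ :=
  Fin.snoc (α := fun _ => ℝ) (pt a y z) k

/-! ### Coordinates on the ambient spaces. -/

section coordinates

variable {m : ℕ}

lemma pt_first (a : ℝ) (y : Fin m → ℝ) (z : ℝ) : pt a y z 0 = a := by
  have : (0 : Fin (m + 2)) = Fin.castSucc (0 : Fin (m + 1)) := rfl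
  rw [this, pt, Fin.snoc_castSucc, Fin.cons_zero]

lemma pt_mid (a : ℝ) (y : Fin m → ℝ) (z : ℝ) (i : Fin m) :
    pt a y z (Fin.castSucc i.succ) = y i := by
  rw [pt, Fin.snoc_castSucc, Fin.cons_succ]

lemma pt_last (a : ℝ) (y : Fin m → ℝ) (z : ℝ) : pt a y z (Fin.last _) = z := by
  rw [pt, Fin.snoc_last]

@[elab_as_elim]
lemma forall_coord {P : Fin (m + 2) → Prop} (h0 : P 0) (h1 : ∀ i : Fin m, P (Fin.castSucc i.succ))
    (h2 : P (Fin.last _)) (j : Fin (m + 2)) : P j := by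
  refine Fin.lastCases h2 (fun j => ?_) j
  exact Fin.cases h0 h1 j

lemma eq_pt (x : Fin (m + 2) → ℝ) :
    x = pt (x 0) (fun i => x (Fin.castSucc i.succ)) (x (Fin.last _)) := by
  funext j
  refine forall_coord ?_ (fun i => ?_) ?_ j
  · rw [pt_first]
  · rw [pt_mid]
  · rw [pt_last]

lemma pt_add (a a' : ℝ) (y y' : Fin m → ℝ) (z z' : ℝ) :
    pt a y z + pt a' y' z' = pt (a + a') (y + y') (z + z') := by
  funext j
  refine forall_coord ?_ (fun i => ?_) ?_ j
  · simp only [Pi.add_apply, pt_first]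
  · simp only [Pi.add_apply, pt_mid]
  · simp only [Pi.add_apply, pt_last]

lemma smul_pt (c a : ℝ) (y : Fin m → ℝ) (z : ℝ) :
    c • pt a y z = pt (c * a) (c • y) (c * z) := by
  funext j
  refine forall_coord ?_ (fun i => ?_) ?_ j
  · simp only [Pi.smul_apply, pt_first, smul_eq_mul]
  · simp only [Pi.smul_apply, pt_mid]
  · simp only [Pi.smul_apply, pt_last, smul_eq_mul]

lemma zero_eq_pt : (0 : Fin (m + 2) → ℝ) = pt 0 (fun _ => 0) 0 := by
  exact (zero_smul ℝ _).symm.trans ((smul_pt 0 0 (0 : Fin m → ℝ) 0).trans (by simp; rfl))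

lemma hpt_castSucc (a : ℝ) (y : Fin m → ℝ) (z k : ℝ) (j : Fin (m + 2)) :
    hpt a y z k j.castSucc = pt a y z j := by
  rw [hpt, Fin.snoc_castSucc]

lemma hpt_last (a : ℝ) (y : Fin m → ℝ) (z k : ℝ) : hpt a y z k (Fin.last _) = k := by
  rw [hpt, Fin.snoc_last]

lemma exists_eq_hpt (x : Fin (m + 2 + 1) → ℝ) : ∃ a y z k, x = hpt a y z k := by
  refine ⟨x (Fin.castSucc 0), fun i => x (Fin.castSucc (Fin.castSucc i.succ)),
    x (Fin.castSucc (Fin.last _)), x (Fin.last _), ?_⟩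
  funext j
  refine Fin.lastCases ?_ (fun j => ?_) j
  · rw [hpt_last]
  · rw [hpt_castSucc]
    exact congrFun (eq_pt fun j : Fin (m + 2) => x j.castSucc) j

lemma hpt_add (a a' : ℝ) (y y' : Fin m → ℝ) (z z' k k' : ℝ) :
    hpt a y z k + hpt a' y' z' k' = hpt (a + a') (y + y') (z + z') (k + k') := by
  funext j
  refine Fin.lastCases ?_ (fun j => ?_) j
  · simp only [Pi.add_apply, hpt_last]
  · simp only [Pi.add_apply, hpt_castSucc, ← pt_add]

lemma smul_hpt (c a : ℝ) (y : Fin m → ℝ) (z k : ℝ) :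
    c • hpt a y z k = hpt (c * a) (c • y) (c * z) (c * k) := by
  funext j
  refine Fin.lastCases ?_ (fun j => ?_) j
  · simp only [Pi.smul_apply, hpt_last, smul_eq_mul]
  · simp only [Pi.smul_apply, hpt_castSucc, ← smul_pt]

lemma hpt_zero : hpt 0 (0 : Fin m → ℝ) 0 0 = 0 := by
  simpa using (smul_hpt 0 0 (0 : Fin m → ℝ) 0 0).symm

lemma hpt_inj {a a' : ℝ} {y y' : Fin m → ℝ} {z z' k k' : ℝ}
    (h : hpt a y z k = hpt a' y' z' k') : a = a' ∧ y = y' ∧ z = z' ∧ k = k' := by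
  have hl := congrFun h (Fin.last _)
  rw [hpt_last, hpt_last] at hl
  have hc (j : Fin (m + 2)) : pt a y z j = pt a' y' z' j := by
    simpa only [hpt_castSucc] using congrFun h j.castSucc
  refine ⟨?_, ?_, ?_, hl⟩
  · simpa only [pt_first] using hc 0
  · funext i
    simpa only [pt_mid] using hc (Fin.castSucc i.succ)
  · simpa only [pt_last] using hc (Fin.last _)

lemma pt_mem_integerPoints {a : ℤ} {y : Fin m → ℤ} {z : ℤ} :
    pt (a : ℝ) (fun i => (y i : ℝ)) z ∈ integerPoints (m + 2) := by
  intro j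
  refine forall_coord ?_ (fun i => ?_) ?_ j
  · exact ⟨a, pt_first _ _ _⟩
  · exact ⟨y i, pt_mid _ _ _ i⟩
  · exact ⟨z, pt_last _ _ _⟩

lemma exists_int_of_hpt_mem {a : ℝ} {y : Fin m → ℝ} {z k : ℝ}
    (h : hpt a y z k ∈ integerPoints (m + 2 + 1)) :
    ∃ (a' : ℤ) (y' : Fin m → ℤ) (z' k' : ℤ),
      a = a' ∧ (∀ i, y i = y' i) ∧ z = z' ∧ k = k' := by
  have hc (j : Fin (m + 2)) : ∃ n : ℤ, pt a y z j = n := by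
    simpa only [hpt_castSucc] using h j.castSucc
  obtain ⟨k', hk⟩ := h (Fin.last _)
  obtain ⟨a', ha⟩ := hc 0
  obtain ⟨z', hz⟩ := hc (Fin.last _)
  have hy (i : Fin m) : ∃ n : ℤ, y i = n := by
    simpa only [pt_mid] using hc (Fin.castSucc i.succ)
  choose y' hy' using hy
  rw [hpt_last] at hk
  rw [pt_first] at ha
  rw [pt_last] at hz
  exact ⟨a', y', z', k', ha, hy', hz, hk⟩

lemma e_first : e (m + 2) 1 = pt 1 (0 : Fin m → ℝ) 0 := by
  funext j
  refine forall_coord ?_ (fun i => ?_) ?_ j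
  · simp [pt_first, e]
  · rw [pt_mid]
    simp [e]
  · simp [pt_last, e]

lemma e_last : e (m + 2) (m + 2) = pt 0 (0 : Fin m → ℝ) 1 := by
  funext j
  refine forall_coord ?_ (fun i => ?_) ?_ j
  · simp [pt_first, e]
  · have := i.2
    simp only [pt_mid, e, Fin.val_castSucc, Fin.val_succ, Pi.zero_apply]
    rw [if_neg (by omega)]
  · simp [pt_last, e]

lemma e_mid (i : Fin m) : e (m + 2) (i + 2) = pt 0 (Pi.single i 1) 0 := by
  funext j
  refine forall_coord ?_ (fun k => ?_) ?_ j
  · simp [pt_first, e]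
  · rw [pt_mid]
    simp [e, Pi.single_apply, Fin.ext_iff]
  · have := i.2
    simp only [pt_last, e, Fin.val_last]
    rw [if_neg (by omega)]

lemma s_eq : s (m + 2) = pt 0 (1 : Fin m → ℝ) 0 := by
  have hs (j : Fin (m + 2)) :
      s (m + 2) j = if (j : ℕ) + 1 ∈ Finset.Icc 2 (m + 2 - 1) then 1 else 0 := by
    simp only [s, Finset.sum_apply, e, Finset.sum_ite_eq]
  funext j
  refine forall_coord ?_ (fun k => ?_) ?_ j
  · simp [pt_first, hs]
  · have := k.2
    rw [hs, pt_mid, if_pos]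
    · rfl
    · simp only [Fin.val_castSucc, Fin.val_succ, Finset.mem_Icc]
      omega
  · simp [pt_last, hs]

end coordinates

/-! ### An outer description of the cone. -/

/-- Real points of the cone over `P_{h, m + 2}`, written as a sum of a dilated point of the
facet `x₁ = 1`, a dilated point of the strip around the diagonal, and nonnegative multiples of
the segments `[e_i, e_i + e_d]`. -/
def InCone (h : ℕ) {m : ℕ} (a : ℝ) (y : Fin m → ℝ) (z k : ℝ) : Prop :=
  ∃ (l : Fin m → ℝ) (p q r t w : ℝ), (∀ i, 0 ≤ l i) ∧ (∀ i, y i = p + q + l i) ∧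
    0 ≤ p ∧ p ≤ a ∧ 0 ≤ q ∧ q ≤ (k - a - ∑ i, l i) * h ∧ z = r + t + w ∧ 0 ≤ w ∧ w ≤ ∑ i, l i ∧
    4 * (a - p) ≤ r ∧ r ≤ 4 * (a - p) + a ∧ 0 ≤ t ∧ t ≤ (k - a - ∑ i, l i) * h ∧
    t - q ≤ k - a - ∑ i, l i ∧ q - t ≤ k - a - ∑ i, l i

section cone

variable {m : ℕ} {h : ℕ}

/-- All conditions are linear and homogeneous in the point and the auxiliary parameters together, so
witnesses add; scaling works likewise. -/
lemma InCone.add {a a' : ℝ} {y y' : Fin m → ℝ} {z z' k k' : ℝ} (H : InCone h a y z k)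
    (H' : InCone h a' y' z' k') : InCone h (a + a') (y + y') (z + z') (k + k') := by
  obtain ⟨l, p, q, r, t, w, h1, h2, h3, h4, h5, h6, h7, h8, h9, h10, h11, h12, h13, h14, h15⟩ := H
  obtain ⟨l', p', q', r', t', w', g1, g2, g3, g4, g5, g6, g7, g8, g9, g10, g11, g12, g13, g14,
    g15⟩ := H'
  refine ⟨l + l', p + p', q + q', r + r', t + t', w + w', fun i => add_nonneg (h1 i) (g1 i),
    fun i => ?_, ?_⟩
  · simp only [Pi.add_apply, h2, g2]
    ring
  · simp only [Pi.add_apply, Finset.sum_add_distrib]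
    refine ⟨?_, ?_, ?_, ?_, ?_, ?_, ?_, ?_, ?_, ?_, ?_, ?_, ?_⟩ <;> linarith

lemma InCone.smul {a : ℝ} {y : Fin m → ℝ} {z k : ℝ} (H : InCone h a y z k) {c : ℝ}
    (hc : 0 ≤ c) : InCone h (c * a) (c • y) (c * z) (c * k) := by
  obtain ⟨l, p, q, r, t, w, h1, h2, h3, h4, h5, h6, h7, h8, h9, h10, h11, h12, h13, h14, h15⟩ := H
  refine ⟨c • l, c * p, c * q, c * r, c * t, c * w, fun i => mul_nonneg hc (h1 i),
    fun i => ?_, ?_⟩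
  · simp only [Pi.smul_apply, smul_eq_mul, h2]
    ring
  · simp only [Pi.smul_apply, smul_eq_mul, ← Finset.mul_sum]
    have k3 := mul_le_mul_of_nonneg_left h3 hc
    have k4 := mul_le_mul_of_nonneg_left h4 hc
    have k5 := mul_le_mul_of_nonneg_left h5 hc
    have k6 := mul_le_mul_of_nonneg_left h6 hc
    have k8 := mul_le_mul_of_nonneg_left h8 hc
    have k9 := mul_le_mul_of_nonneg_left h9 hc
    have k10 := mul_le_mul_of_nonneg_left h10 hc
    have k11 := mul_le_mul_of_nonneg_left h11 hc
    have k12 := mul_le_mul_of_nonneg_left h12 hc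
    have k13 := mul_le_mul_of_nonneg_left h13 hc
    have k14 := mul_le_mul_of_nonneg_left h14 hc
    have k15 := mul_le_mul_of_nonneg_left h15 hc
    have k7 := congrArg (fun x => c * x) h7
    refine ⟨?_, ?_, ?_, ?_, ?_, ?_, ?_, ?_, ?_, ?_, ?_, ?_, ?_⟩ <;> linarith

/-- The points satisfying `InCone`, as a submodule over `ℝ≥0`. -/
def coneSubmodule (h m : ℕ) : Submodule ℝ≥0 (Fin (m + 2 + 1) → ℝ) where
  carrier := {x | ∃ a y z k, x = hpt a y z k ∧ InCone h a y z k}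
  add_mem' := by
    rintro _ _ ⟨a, y, z, k, rfl, H⟩ ⟨a', y', z', k', rfl, H'⟩
    exact ⟨_, _, _, _, hpt_add .., H.add H'⟩
  zero_mem' := ⟨0, 0, 0, 0, hpt_zero.symm, 0, 0, 0, 0, 0, 0, by simp⟩
  smul_mem' := by
    rintro c _ ⟨a, y, z, k, rfl, H⟩
    exact ⟨_, _, _, _, smul_hpt .., H.smul c.2⟩

lemma hpt_mem_coneSubmodule {a : ℝ} {y : Fin m → ℝ} {z k : ℝ} :
    hpt a y z k ∈ coneSubmodule h m ↔ InCone h a y z k := by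
  refine ⟨?_, fun H => ⟨_, _, _, _, rfl, H⟩⟩
  rintro ⟨a', y', z', k', he, H⟩
  obtain ⟨rfl, rfl, rfl, rfl⟩ := hpt_inj he
  exact H

lemma convex_coneSubmodule : Convex ℝ (coneSubmodule h m : Set (Fin (m + 2 + 1) → ℝ)) := by
  intro x hx y hy a b ha hb _
  exact add_mem ((coneSubmodule h m).smul_mem ⟨a, ha⟩ hx) ((coneSubmodule h m).smul_mem ⟨b, hb⟩ hy)

lemma inCone_of_diagonal {c z k : ℝ} (h0 : 0 ≤ c) (h1 : c ≤ k * h) (h2 : 0 ≤ z) (h3 : z ≤ k * h)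
    (h4 : z - c ≤ k) (h5 : c - z ≤ k) : InCone h 0 (fun _ : Fin m => c) z k := by
  refine ⟨0, 0, c, 0, z, 0, ?_⟩
  simp [h0, h1, h2, h3]
  constructor <;> linarith

lemma inCone_of_facet {a c z : ℝ} (h0 : 0 ≤ c) (h1 : c ≤ a) (h2 : 4 * (a - c) ≤ z)
    (h3 : z ≤ 4 * (a - c) + a) : InCone h a (fun _ : Fin m => c) z a := by
  refine ⟨0, c, 0, z, 0, 0, ?_⟩
  simp [h0, h1, h2, h3]

lemma inCone_single (i : Fin m) {z : ℝ} (h0 : 0 ≤ z) (h1 : z ≤ 1) :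
    InCone h 0 (Pi.single i 1) z 1 := by
  refine ⟨Pi.single i 1, 0, 0, 0, 0, z, ?_⟩
  have h2 : ∀ j, 0 ≤ (Pi.single i 1 : Fin m → ℝ) j := by
    intro j
    rw [Pi.single_apply]
    split_ifs <;> norm_num
  simp [h0, h1, h2]

end cone

/-! ### Explicit generators and the vertices. -/

section generators

variable {m : ℕ} {h : ℕ}

/-- The integer points of the facet `x₁ = 1`, of the strip around the diagonal, and of the
segments `[e_i, e_i + e_d]`. -/
inductive IsGen (h : ℕ) {m : ℕ} : ℤ → (Fin m → ℤ) → ℤ → Prop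
  | diag (c z : ℤ) (h0 : 0 ≤ c) (h1 : c ≤ h) (h2 : 0 ≤ z) (h3 : z ≤ h) (h4 : z - c ≤ 1)
      (h5 : c - z ≤ 1) : IsGen h 0 (fun _ => c) z
  | facet (c z : ℤ) (h0 : 0 ≤ c) (h1 : c ≤ 1) (h2 : 4 * (1 - c) ≤ z)
      (h3 : z ≤ 4 * (1 - c) + 1) : IsGen h 1 (fun _ => c) z
  | single (i : Fin m) (z : ℤ) (h0 : 0 ≤ z) (h1 : z ≤ 1) : IsGen h 0 (Pi.single i 1) z

lemma IsGen.inCone {a z : ℤ} {y : Fin m → ℤ} (H : IsGen h a y z) :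
    InCone h (a : ℝ) (fun i => (y i : ℝ)) z 1 := by
  cases H with
  | diag c z h0 h1 h2 h3 h4 h5 =>
    rw [Int.cast_zero]
    apply inCone_of_diagonal <;> try rw [one_mul]
    all_goals exact_mod_cast ‹_›
  | facet c z h0 h1 h2 h3 =>
    rw [Int.cast_one]
    apply inCone_of_facet <;> exact_mod_cast ‹_›
  | single i z h0 h1 =>
    have : (fun j => ((Pi.single i 1 : Fin m → ℤ) j : ℝ)) = Pi.single i 1 := by
      funext j
      simp [Pi.single_apply]
    rw [this, Int.cast_zero]
    apply inCone_single <;> exact_mod_cast ‹_›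

lemma exists_isGen_of_mem (hh : 1 ≤ h) {x : Fin (m + 2) → ℝ}
    (hx : x ∈ uPoints h (m + 2) ∪ vPoints (m + 2)) :
    ∃ a y z, IsGen h a y z ∧ x = pt (a : ℝ) (fun i => ((y i : ℤ) : ℝ)) (z : ℝ) := by
  have aux {a c z a' c' z' : ℝ} (ha : a = a') (hc : c = c') (hz : z = z') :
      pt a (fun _ : Fin m => c) z = pt a' (fun _ => c') z' := by rw [ha, hc, hz]
  have e1 : e (m + 2) 1 = pt 1 (fun _ : Fin m => 0) 0 := e_first
  have ed : e (m + 2) (m + 2) = pt 0 (fun _ : Fin m => 0) 1 := e_last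
  have es : s (m + 2) = pt 0 (fun _ : Fin m => 1) 0 := s_eq
  have padd (a c z a' c' z' : ℝ) : pt a (fun _ : Fin m => c) z + pt a' (fun _ => c') z' =
      pt (a + a') (fun _ => c + c') (z + z') := pt_add ..
  have psmul (b a c z : ℝ) : b • pt a (fun _ : Fin m => c) z =
      pt (b * a) (fun _ => b * c) (b * z) := smul_pt ..
  have hh' : (1 : ℤ) ≤ h := by exact_mod_cast hh
  rcases hx with hx | ⟨i, hi, hx⟩
  · simp only [uPoints, Set.mem_insert_iff, Set.mem_singleton_iff, e1, ed, es, psmul, padd] at hx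
    rcases hx with rfl | rfl | rfl | rfl | rfl | rfl | rfl | rfl | rfl | rfl
    · exact ⟨_, _, _, .diag 0 0 (by omega) (by omega) (by omega) (by omega) (by omega) (by omega),
        zero_eq_pt.trans (aux (by simp) (by simp) (by simp))⟩
    · exact ⟨_, _, _, .diag 0 1 (by omega) (by omega) (by omega) (by omega) (by omega) (by omega),
        aux (by simp) (by simp) (by simp)⟩
    · exact ⟨_, _, _, .diag 1 0 (by omega) (by omega) (by omega) (by omega) (by omega) (by omega),
        aux (by simp) (by simp) (by simp)⟩
    · exact ⟨_, _, _, .diag h h (by omega) (by omega) (by omega) (by omega) (by omega) (by omega),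
        aux (by simp) (by simp) (by simp)⟩
    · exact ⟨_, _, _, .diag (h - 1) h (by omega) (by omega) (by omega) (by omega) (by omega)
        (by omega), aux (by simp) (by simp) (by simp)⟩
    · exact ⟨_, _, _, .diag h (h - 1) (by omega) (by omega) (by omega) (by omega) (by omega)
        (by omega), aux (by simp) (by simp) (by simp)⟩
    · exact ⟨_, _, _, .facet 0 4 (by omega) (by omega) (by omega) (by omega),
        aux (by simp) (by simp) (by simp)⟩
    · exact ⟨_, _, _, .facet 0 5 (by omega) (by omega) (by omega) (by omega),
        aux (by simp) (by simp) (by simp)⟩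
    · exact ⟨_, _, _, .facet 1 0 (by omega) (by omega) (by omega) (by omega),
        aux (by simp) (by simp) (by simp)⟩
    · exact ⟨_, _, _, .facet 1 1 (by omega) (by omega) (by omega) (by omega),
        aux (by simp) (by simp) (by simp)⟩
  · rw [Finset.mem_Icc] at hi
    obtain ⟨i, rfl⟩ : ∃ j : Fin m, i = j + 2 := ⟨⟨i - 2, by omega⟩, by simp; omega⟩
    have hs : (fun j => ((Pi.single i 1 : Fin m → ℤ) j : ℝ)) = Pi.single i 1 := by
      funext j
      simp [Pi.single_apply]
    rcases hx with rfl | rfl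
    · refine ⟨_, _, _, .single i 0 (by omega) (by omega), ?_⟩
      rw [e_mid, hs]
      simp
    · refine ⟨_, _, _, .single i 1 (by omega) (by omega), ?_⟩
      rw [e_mid, e_last, pt_add, hs]
      simp

lemma convex_polytopeP (h d : ℕ) : Convex ℝ (polytopeP h d) := convex_convexHull ℝ _

lemma segment_mem {c z c' z' : ℝ}
    (h0 : pt 0 (fun _ : Fin m => c) z ∈ polytopeP h (m + 2))
    (h1 : pt 0 (fun _ : Fin m => c') z' ∈ polytopeP h (m + 2)) {j n : ℕ} (hj : j ≤ n)
    (hc : c' = c + n) (hz : z' = z + n) :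
    pt 0 (fun _ : Fin m => c + j) (z + j) ∈ polytopeP h (m + 2) := by
  -- The segment degenerates to a point for two of the three diagonals when `h = 1`.
  rcases Nat.eq_zero_or_pos n with rfl | hpos
  · obtain rfl : j = 0 := by omega
    simpa using h0
  · have hn' : (0 : ℝ) < n := by exact_mod_cast hpos
    have hj' : (j : ℝ) ≤ n := by exact_mod_cast hj
    have := convex_polytopeP h (m + 2) h0 h1 (a := 1 - j / n) (b := j / n)
      (by rw [sub_nonneg, div_le_one hn']; exact hj') (by positivity) (by ring)
    rw [smul_pt, smul_pt, pt_add] at this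
    have e1 : (1 - (j : ℝ) / n) * 0 + j / n * 0 = 0 := by ring
    have e2 : (1 - (j : ℝ) / n) * z + j / n * z' = z + j := by
      rw [hz]
      field_simp
      ring
    have e3 : ((1 - (j : ℝ) / n) • fun _ : Fin m => c) + ((j : ℝ) / n) • (fun _ : Fin m => c') =
        fun _ => c + j := by
      funext i
      simp only [Pi.add_apply, Pi.smul_apply, smul_eq_mul]
      rw [hc]
      field_simp
      ring
    rwa [e1, e2, e3] at this

end generators

/-! ### Lattice points of the polytope and its homogenization. -/

section lattice_points

variable {m : ℕ} {h : ℕ}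

lemma uPoints_subset {x : Fin (m + 2) → ℝ} (hx : x ∈ uPoints h (m + 2)) :
    x ∈ polytopeP h (m + 2) :=
  subset_convexHull ℝ _ (Or.inl hx)

lemma vPoints_subset {x : Fin (m + 2) → ℝ} (hx : x ∈ vPoints (m + 2)) :
    x ∈ polytopeP h (m + 2) :=
  subset_convexHull ℝ _ (Or.inr hx)

lemma exists_mem_uPoints : ∀ x ∈ ({pt 0 (fun _ => 0) 0, pt 0 (fun _ => 0) 1, pt 0 (fun _ => 1) 0,
    pt 0 (fun _ => (h : ℝ)) h, pt 0 (fun _ => (h : ℝ) - 1) h, pt 0 (fun _ => (h : ℝ)) (h - 1),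
    pt 1 (fun _ => 0) 4, pt 1 (fun _ => 0) 5, pt 1 (fun _ => 1) 0, pt 1 (fun _ => 1) 1} :
    Set (Fin (m + 2) → ℝ)), x ∈ uPoints h (m + 2) := by
  have e1 : e (m + 2) 1 = pt 1 (fun _ : Fin m => 0) 0 := e_first
  have ed : e (m + 2) (m + 2) = pt 0 (fun _ : Fin m => 0) 1 := e_last
  have es : s (m + 2) = pt 0 (fun _ : Fin m => 1) 0 := s_eq
  have padd (a c z a' c' z' : ℝ) : pt a (fun _ : Fin m => c) z + pt a' (fun _ => c') z' =
      pt (a + a') (fun _ => c + c') (z + z') := pt_add ..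
  have psmul (b a c z : ℝ) : b • pt a (fun _ : Fin m => c) z =
      pt (b * a) (fun _ => b * c) (b * z) := smul_pt ..
  intro x hx
  simp only [uPoints, e1, ed, es, psmul, padd, zero_eq_pt]
  simpa using hx

lemma IsGen.mem_polytopeP (hh : 1 ≤ h) {a z : ℤ} {y : Fin m → ℤ} (H : IsGen h a y z) :
    pt (a : ℝ) (fun i => (y i : ℝ)) z ∈ polytopeP h (m + 2) := by
  have hu := fun x hx => uPoints_subset (exists_mem_uPoints (h := h) (m := m) x hx)
  simp only [Set.mem_insert_iff, Set.mem_singleton_iff, forall_eq_or_imp, forall_eq] at hu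
  obtain ⟨u1, u2, u3, u4, u5, u6, u7, u8, u9, u10⟩ := hu
  cases H with
  | diag c z h0 h1 h2 h3 h4 h5 =>
    rw [Int.cast_zero]
    lift c to ℕ using h0
    -- The integer points of the strip lie on three parallel segments, each joining two of the given
    -- points.
    rcases (by omega : z = c ∨ z = c + 1 ∨ z = c - 1) with rfl | rfl | rfl
    · simpa using segment_mem u1 u4 (j := c) (n := h) (by omega) (by simp) (by simp)
    · simpa [add_comm] using segment_mem u2 u5 (j := c) (n := h - 1) (by omega)
        (by push_cast [Nat.cast_sub hh]; ring) (by push_cast [Nat.cast_sub hh]; ring)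
    · have := segment_mem u3 u6 (j := c - 1) (n := h - 1) (by omega)
        (by push_cast [Nat.cast_sub hh]; ring) (by push_cast [Nat.cast_sub hh]; ring)
      simpa [Nat.cast_sub (by omega : 1 ≤ c)] using this
  | facet c z h0 h1 h2 h3 =>
    rw [Int.cast_one]
    rcases (by omega : (c = 0 ∧ (z = 4 ∨ z = 5)) ∨ (c = 1 ∧ (z = 0 ∨ z = 1))) with
      ⟨rfl, rfl | rfl⟩ | ⟨rfl, rfl | rfl⟩
    · simpa using u7
    · simpa using u8
    · simpa using u9
    · simpa using u10
  | single i z h0 h1 =>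
    have hs : (fun j => ((Pi.single i 1 : Fin m → ℤ) j : ℝ)) = Pi.single i 1 := by
      funext j
      simp [Pi.single_apply]
    rw [hs, Int.cast_zero]
    refine vPoints_subset ⟨i + 2, by simp, ?_⟩
    rw [e_mid, e_last, pt_add]
    rcases (by omega : z = 0 ∨ z = 1) with rfl | rfl
    · left; simp
    · right; simp

lemma hpt_mem_latticeGens {P : Set (Fin (m + 2) → ℝ)} {a z : ℤ} {y : Fin m → ℤ}
    (H : pt (a : ℝ) (fun i => (y i : ℝ)) z ∈ P) :
    hpt (a : ℝ) (fun i => (y i : ℝ)) z 1 ∈ latticeGens P := by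
  refine ⟨subset_convexHull ℝ _ ⟨_, H, rfl⟩, fun j => ?_⟩
  refine Fin.lastCases ⟨1, by rw [hpt_last]; simp⟩ (fun j => ?_) j
  rw [hpt_castSucc]
  exact pt_mem_integerPoints j

lemma homogenization_last {n : ℕ} {P : Set (Fin n → ℝ)} {x : Fin (n + 1) → ℝ}
    (hx : x ∈ homogenization P) : x (Fin.last n) = 1 := by
  have hc : Convex ℝ {x : Fin (n + 1) → ℝ | x (Fin.last n) = 1} :=
    convex_hyperplane (LinearMap.proj (Fin.last n) : (Fin (n + 1) → ℝ) →ₗ[ℝ] ℝ).isLinear 1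
  refine convexHull_min ?_ hc hx
  rintro _ ⟨α, _, rfl⟩
  simp

lemma homogenization_subset (hh : 1 ≤ h) :
    homogenization (polytopeP h (m + 2)) ⊆ coneSubmodule h m := by
  refine convexHull_min ?_ convex_coneSubmodule
  rw [Set.image_subset_iff]
  refine convexHull_min (fun x hx => ?_) ?_
  · obtain ⟨a, y, z, H, rfl⟩ := exists_isGen_of_mem hh hx
    exact hpt_mem_coneSubmodule.2 H.inCone
  · intro x hx y hy a b ha hb hab
    have := convex_coneSubmodule hx hy ha hb hab
    rw [Set.mem_preimage]
    convert this using 1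
    funext j
    refine Fin.lastCases ?_ (fun j => ?_) j
    · simp [hab]
    · simp

lemma exists_of_mem_latticeGens (hh : 1 ≤ h) {x : Fin (m + 2 + 1) → ℝ}
    (hx : x ∈ latticeGens (polytopeP h (m + 2))) :
    ∃ (a : ℤ) (y : Fin m → ℤ) (z : ℤ), x = hpt (a : ℝ) (fun i => (y i : ℝ)) z 1 ∧
      InCone h (a : ℝ) (fun i => (y i : ℝ)) z 1 := by
  obtain ⟨a, y, z, k, rfl⟩ := exists_eq_hpt x
  have h1 := homogenization_last hx.1
  rw [hpt_last] at h1
  subst h1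
  obtain ⟨a', y', z', k', rfl, hy, rfl, -⟩ := exists_int_of_hpt_mem hx.2
  obtain rfl : y = fun i => (y' i : ℝ) := funext hy
  exact ⟨a', y', z', rfl, hpt_mem_coneSubmodule.1 (homogenization_subset hh hx.1)⟩

lemma cone_subset (hh : 1 ≤ h) : cone (polytopeP h (m + 2)) ⊆ coneSubmodule h m :=
  Submodule.span_le.2 fun _ hx => homogenization_subset hh hx.1

lemma lattice_subset {n : ℕ} (P : Set (Fin n → ℝ)) : lattice P ⊆ integerPoints (n + 1) := by
  intro x hx
  refine AddSubgroup.closure_induction (p := fun x _ => x ∈ integerPoints (n + 1))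
    (fun x hx => hx.2) (fun i => ⟨0, by simp⟩) ?_ ?_ hx
  · intro x y _ _ hx hy i
    obtain ⟨a, ha⟩ := hx i
    obtain ⟨b, hb⟩ := hy i
    exact ⟨a + b, by simp [ha, hb]⟩
  · intro x _ hx i
    obtain ⟨a, ha⟩ := hx i
    exact ⟨-a, by simp [ha]⟩

lemma exists_add_of_mem_semigroup {n : ℕ} {P : Set (Fin n → ℝ)} {x : Fin (n + 1) → ℝ}
    (hx : x ∈ semigroup P) (h2 : x (Fin.last n) = 2) :
    ∃ u ∈ latticeGens P, ∃ v ∈ latticeGens P, x = u + v := by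
  -- Generators have degree 1, so the degree counts summands. Degrees 0 and 1 are tracked as well to
  -- make the induction close.
  have key : ∃ k : ℕ, x (Fin.last n) = (k : ℝ) ∧ (k = 0 → x = 0) ∧ (k = 1 → x ∈ latticeGens P) ∧
      (k = 2 → ∃ u ∈ latticeGens P, ∃ v ∈ latticeGens P, x = u + v) := by
    clear h2
    refine AddSubmonoid.closure_induction_left (motive := fun x _ => ∃ k : ℕ, x (Fin.last n) = (k : ℝ) ∧
      (k = 0 → x = 0) ∧ (k = 1 → x ∈ latticeGens P) ∧
      (k = 2 → ∃ u ∈ latticeGens P, ∃ v ∈ latticeGens P, x = u + v)) ?_ ?_ hx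
    · exact ⟨0, by simp⟩
    · rintro u hu v - ⟨k, hk, h0, h1, -⟩
      refine ⟨k + 1, ?_, by omega, fun hk1 => ?_, fun hk2 => ?_⟩
      · simp [hk, homogenization_last hu.1, add_comm]
      · rwa [h0 (by omega), add_zero]
      · exact ⟨u, hu, v, h1 (by omega), rfl⟩
  obtain ⟨k, hk, -, -, H⟩ := key
  refine H ?_
  rw [h2] at hk
  exact_mod_cast hk.symm

end lattice_points

/-! ### Integer arithmetic of the decomposition. -/

section decomposition

/-- Here `H` stands for `b * h`. Each `p` allows an interval of values of `z`, and the hypotheses on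
`z` bound the union of these intervals. The excluded case is the only one in which two neighbouring
intervals have an integer strictly between them. -/
lemma exists_facet_coordinate {a b H c z : ℤ} (ha : 0 ≤ a) (hb : 0 ≤ b) (hbH : b ≤ H)
    (hb0 : b = 0 → H = 0) (hc : 0 ≤ c) (hcH : c ≤ a + H) (h1 : 0 ≤ z) (h2 : c - a - b ≤ z)
    (h3 : 4 * (a - c) ≤ z) (h4 : z ≤ 5 * a + H) (h5 : z ≤ 5 * a + c + b)
    (h6 : z ≤ 5 * a + 5 * H - 4 * c)
    (hne : ¬(a = 1 ∧ b = 1 ∧ 1 ≤ c ∧ c ≤ H ∧ z = c + 2)) :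
    ∃ p, 0 ≤ p ∧ p ≤ a ∧ p ≤ c ∧ c - p ≤ H ∧ 4 * (a - p) + max 0 (c - p - b) ≤ z ∧
      z ≤ 4 * (a - p) + a + min H (c - p + b) := by
  -- Upper ends fall as `p` grows. By `h4`, `h5` and `h6` the smallest possible `p`, namely `max 0
  -- (c - H)`, has an upper end reaching `z`; the greatest such `p` is taken. Then either `p + 1` is
  -- out of range or its interval ends below `z`, and `z` clears the lower end for `p`.
  obtain ⟨p, ⟨hp1, hp2, hp3, hp4, hp5⟩, hmax⟩ := Int.exists_greatest_of_bdd
    (P := fun p => 0 ≤ p ∧ p ≤ a ∧ p ≤ c ∧ c - p ≤ H ∧ z ≤ 4 * (a - p) + a + min H (c - p + b))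
    ⟨a, fun p hp => hp.2.1⟩ ⟨max 0 (c - H), by omega⟩
  refine ⟨p, hp1, hp2, hp3, hp4, ?_, hp5⟩
  have hm := hmax (p + 1)
  omega

lemma exists_decomposition {a b H c z D : ℤ} (ha : 0 ≤ a) (hb : 0 ≤ b) (hbH : b ≤ H)
    (hb0 : b = 0 → H = 0) (hc : 0 ≤ c) (hcH : c ≤ a + H) (hD : 0 ≤ D) (h1 : 0 ≤ z)
    (h2 : c - a - b ≤ z) (h3 : 4 * (a - c) ≤ z) (h4 : z ≤ 5 * a + H + D)
    (h5 : z ≤ 5 * a + c + b + D) (h6 : z ≤ 5 * a + 5 * H - 4 * c + D)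
    (hne : ¬(a = 1 ∧ b = 1 ∧ 1 ≤ c ∧ c ≤ H ∧ D = 0 ∧ z = c + 2)) :
    ∃ p q r t w : ℤ, c = p + q ∧ z = r + t + w ∧ 0 ≤ p ∧ p ≤ a ∧ 0 ≤ q ∧ q ≤ H ∧
      4 * (a - p) ≤ r ∧ r ≤ 4 * (a - p) + a ∧ 0 ≤ t ∧ t ≤ H ∧ t ≤ q + b ∧ q ≤ t + b ∧
      0 ≤ w ∧ w ≤ D := by
  obtain ⟨w, hw0, hwD, g1, g2, g3, g4, g5, g6, gne⟩ : ∃ w, 0 ≤ w ∧ w ≤ D ∧ 0 ≤ z - w ∧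
      c - a - b ≤ z - w ∧ 4 * (a - c) ≤ z - w ∧ z - w ≤ 5 * a + H ∧ z - w ≤ 5 * a + c + b ∧
      z - w ≤ 5 * a + 5 * H - 4 * c ∧
      ¬(a = 1 ∧ b = 1 ∧ 1 ≤ c ∧ c ≤ H ∧ z - w = c + 2) := by
    by_cases hex : a = 1 ∧ b = 1 ∧ 1 ≤ c ∧ c ≤ H
    -- The largest `w` that respects the lower bounds. If it lands on the exceptional value, a shift
    -- by one escapes it, since `D = 0` is then excluded.
    · obtain ⟨w, hw⟩ : ∃ w, w = z - max (z - D) (max 0 (max (c - a - b) (4 * (a - c)))) := ⟨_, rfl⟩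
      by_cases hz : z - w = c + 2
      · by_cases hw1 : 1 ≤ w
        · exact ⟨w - 1, by omega⟩
        · exact ⟨w + 1, by omega⟩
      · exact ⟨w, by omega⟩
    · exact ⟨z - max (z - D) (max 0 (max (c - a - b) (4 * (a - c)))), by omega⟩
  obtain ⟨p, hp⟩ := exists_facet_coordinate ha hb hbH hb0 hc hcH g1 g2 g3 g4 g5 g6 gne
  -- The smallest `r` for which the remainder `t` stays below its bounds `H` and `q + b`.
  obtain ⟨r, hr⟩ : ∃ r, r = max (4 * (a - p)) (z - w - min H (c - p + b)) := ⟨_, rfl⟩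
  exact ⟨p, c - p, r, z - w - r, w, by omega⟩

end decomposition

/-! ### Determination of the holes. -/

section holes

variable {m : ℕ} {h : ℕ}

lemma nsmul_hpt (n : ℕ) (a : ℝ) (y : Fin m → ℝ) (z k : ℝ) :
    n • hpt a y z k = hpt (n * a) ((n : ℝ) • y) (n * z) (n * k) := by
  rw [← Nat.cast_smul_eq_nsmul ℝ, smul_hpt]

lemma IsGen.mem_latticeGens (hh : 1 ≤ h) {a z : ℤ} {y : Fin m → ℤ} (H : IsGen h a y z) :
    hpt (a : ℝ) (fun i => (y i : ℝ)) z 1 ∈ latticeGens (polytopeP h (m + 2)) :=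
  hpt_mem_latticeGens (H.mem_polytopeP hh)

lemma IsGen.mem_semigroup (hh : 1 ≤ h) {a z : ℤ} {y : Fin m → ℤ} (H : IsGen h a y z) :
    hpt (a : ℝ) (fun i => (y i : ℝ)) z 1 ∈ semigroup (polytopeP h (m + 2)) :=
  AddSubmonoid.subset_closure (H.mem_latticeGens hh)

lemma add_mem_semigroup {n : ℕ} {P : Set (Fin n → ℝ)} {x y : Fin (n + 1) → ℝ}
    (hx : x ∈ semigroup P) (hy : y ∈ semigroup P) : x + y ∈ semigroup P :=
  (AddSubmonoid.closure (latticeGens P)).add_mem hx hy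

lemma nsmul_mem_semigroup {n : ℕ} {P : Set (Fin n → ℝ)} {x : Fin (n + 1) → ℝ}
    (hx : x ∈ semigroup P) (k : ℕ) : k • x ∈ semigroup P :=
  (AddSubmonoid.closure (latticeGens P)).nsmul_mem hx k

lemma facet_mem_semigroup (hh : 1 ≤ h) {a p r : ℤ} (h0 : 0 ≤ p) (h1 : p ≤ a)
    (h2 : 4 * (a - p) ≤ r) (h3 : r ≤ 4 * (a - p) + a) :
    hpt (a : ℝ) (fun _ : Fin m => (p : ℝ)) r a ∈ semigroup (polytopeP h (m + 2)) := by
  obtain ⟨n1, n2, n3, n4, ha, hp, hr⟩ : ∃ n1 n2 n3 n4 : ℕ, a = n1 + n2 + n3 + n4 ∧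
      p = n3 + n4 ∧ r = 4 * n1 + 5 * n2 + n4 := by
    -- The surplus `r - 4 * (a - p)` counts upper endpoints; as many as possible are placed over `c
    -- = 1`, the rest over `c = 0`.
    obtain ⟨n, hn⟩ : ∃ n, n = min p (r - 4 * (a - p)) := ⟨_, rfl⟩
    exact ⟨(a - p - (r - 4 * (a - p) - n)).toNat, (r - 4 * (a - p) - n).toNat, (p - n).toNat,
      n.toNat, by omega⟩
  have g1 := (IsGen.facet (h := h) (m := m) 0 4 (by omega) (by omega) (by omega)
    (by omega)).mem_semigroup hh
  have g2 := (IsGen.facet (h := h) (m := m) 0 5 (by omega) (by omega) (by omega)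
    (by omega)).mem_semigroup hh
  have g3 := (IsGen.facet (h := h) (m := m) 1 0 (by omega) (by omega) (by omega)
    (by omega)).mem_semigroup hh
  have g4 := (IsGen.facet (h := h) (m := m) 1 1 (by omega) (by omega) (by omega)
    (by omega)).mem_semigroup hh
  have := add_mem_semigroup (add_mem_semigroup (nsmul_mem_semigroup g1 n1)
    (nsmul_mem_semigroup g2 n2)) (add_mem_semigroup (nsmul_mem_semigroup g3 n3)
    (nsmul_mem_semigroup g4 n4))
  simp only [nsmul_hpt, hpt_add] at this
  convert this using 1
  subst ha hp hr
  congr 1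
  · push_cast; ring
  · funext i
    simp
  · push_cast; ring
  · push_cast; ring

/-- Induction on the degree: one strip point is peeled off, on the same side of the diagonal as `(q,
t)` and as far out as possible, so that the remainder fits the strip dilated by `b`. -/
lemma diagonal_mem_semigroup (hh : 1 ≤ h) (b : ℕ) : ∀ {q t : ℤ}, 0 ≤ q → q ≤ b * h → 0 ≤ t →
    t ≤ b * h → t ≤ q + b → q ≤ t + b →
    hpt 0 (fun _ : Fin m => (q : ℝ)) t b ∈ semigroup (polytopeP h (m + 2)) := by
  induction b with
  | zero =>
    intro q t h0 h1 h2 h3 h4 h5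
    obtain rfl : q = 0 := by simp at h1; omega
    obtain rfl : t = 0 := by simp at h3; omega
    have : (hpt 0 (fun _ : Fin m => ((0 : ℤ) : ℝ)) ((0 : ℤ) : ℝ) ((0 : ℕ) : ℝ)) = 0 := by
      rw [← hpt_zero]
      congr 1
      · funext i; simp
      · simp
      · simp
    rw [this]
    exact (AddSubmonoid.closure _).zero_mem
  | succ b ih =>
    intro q t h0 h1 h2 h3 h4 h5
    have hb : (b : ℤ) ≤ b * h := le_mul_of_one_le_right (by positivity) (by exact_mod_cast hh)
    have hb1 : ((b + 1 : ℕ) : ℤ) * h = b * h + h := by push_cast; ring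
    have hh' : (1 : ℤ) ≤ h := by exact_mod_cast hh
    rw [hb1] at h1 h3
    push_cast at h4 h5
    obtain ⟨q', t', g⟩ : ∃ q' t' : ℤ, 0 ≤ q' ∧ q' ≤ h ∧ 0 ≤ t' ∧ t' ≤ h ∧ t' - q' ≤ 1 ∧
        q' - t' ≤ 1 ∧ 0 ≤ q - q' ∧ q - q' ≤ b * h ∧ 0 ≤ t - t' ∧ t - t' ≤ b * h ∧
        t - t' ≤ q - q' + b ∧ q - q' ≤ t - t' + b := by
      rcases lt_trichotomy q t with hlt | rfl | hlt
      · exact ⟨min ((h : ℤ) - 1) q, min ((h : ℤ) - 1) q + 1, by omega⟩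
      · exact ⟨min h q, min h q, by omega⟩
      · exact ⟨min ((h : ℤ) - 1) t + 1, min ((h : ℤ) - 1) t, by omega⟩
    obtain ⟨g1, g2, g3, g4, g5, g6, g7, g8, g9, g10, g11, g12⟩ := g
    have := add_mem_semigroup (ih g7 g8 g9 g10 g11 g12)
      ((IsGen.diag (m := m) q' t' g1 g2 g3 g4 g5 g6).mem_semigroup hh)
    rw [hpt_add] at this
    convert this using 1
    congr 1
    · simp
    · funext i; simp
    · simp
    · push_cast; ring

lemma single_mem_semigroup (hh : 1 ≤ h) (i : Fin m) {n w : ℤ} (h0 : 0 ≤ w) (h1 : w ≤ n) :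
    hpt 0 (Pi.single i (n : ℝ)) w n ∈ semigroup (polytopeP h (m + 2)) := by
  obtain ⟨n1, n2, rfl, rfl⟩ : ∃ n1 n2 : ℕ, n = n1 + n2 ∧ w = n2 :=
    ⟨(n - w).toNat, w.toNat, by omega⟩
  have g1 := (IsGen.single (h := h) i 0 (by omega) (by omega)).mem_semigroup hh
  have g2 := (IsGen.single (h := h) i 1 (by omega) (by omega)).mem_semigroup hh
  have := add_mem_semigroup (nsmul_mem_semigroup g1 n1) (nsmul_mem_semigroup g2 n2)
  rw [nsmul_hpt, nsmul_hpt, hpt_add] at this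
  convert this using 1
  congr 1
  · simp
  · funext j
    simp only [Pi.single_apply, Pi.add_apply, Pi.smul_apply, smul_eq_mul]
    split_ifs <;> simp
  · simp
  · simp

lemma sum_single_mem_semigroup (hh : 1 ≤ h) {f : Fin m → ℤ} (hf : ∀ i, 0 ≤ f i)
    (I : Finset (Fin m)) : ∀ {w : ℤ}, 0 ≤ w → w ≤ ∑ i ∈ I, f i →
    hpt 0 (∑ i ∈ I, Pi.single i (f i : ℝ)) w ((∑ i ∈ I, f i : ℤ) : ℝ) ∈
      semigroup (polytopeP h (m + 2)) := by
  induction I using Finset.induction_on with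
  | empty =>
    intro w h0 h1
    rw [Finset.sum_empty] at h1
    obtain rfl : w = 0 := le_antisymm h1 h0
    simp only [Finset.sum_empty, Int.cast_zero, hpt_zero]
    exact (AddSubmonoid.closure _).zero_mem
  | insert i I hi ih =>
    intro w h0 h1
    rw [Finset.sum_insert hi] at h1
    have h2 : 0 ≤ ∑ j ∈ I, f j := Finset.sum_nonneg fun j _ => hf j
    have h3 := hf i
    have := add_mem_semigroup (single_mem_semigroup hh i (n := f i) (w := min w (f i)) (by omega)
      (by omega)) (ih (w := w - min w (f i)) (by omega) (by omega))
    rw [hpt_add] at this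
    convert this using 1
    rw [Finset.sum_insert hi, Finset.sum_insert hi]
    congr 1
    · simp
    · push_cast; ring
    · push_cast; ring

/-- The holes of `P_{h, m + 2}`. -/
def holePoint (m j : ℕ) : Fin (m + 2 + 1) → ℝ :=
  hpt 1 (fun _ : Fin m => (j : ℝ)) (j + 2) 2

/-- If `i0` minimizes `y`, then `l i0` is the common part of all segment coefficients. Equal
multiples of all the `e_i` add up to a diagonal vector, so this part can move to the strip, along
with the degree `m * l i0` that it frees. The bounds then follow by eliminating the real parameters.
-/
lemma inCone_int [Nonempty (Fin m)] (hh : 1 ≤ h) {a z k : ℤ} {y : Fin m → ℤ}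
    (H : InCone h (a : ℝ) (fun i => (y i : ℝ)) z k) :
    ∃ c b D : ℤ, (∀ i, c ≤ y i) ∧ D = ∑ i, (y i - c) ∧ k = a + b + D ∧ 0 ≤ a ∧ 0 ≤ b ∧
      0 ≤ c ∧ c ≤ a + b * h ∧ 0 ≤ z ∧ c - a - b ≤ z ∧ 4 * (a - c) ≤ z ∧ z ≤ 5 * a + b * h + D ∧
      z ≤ 5 * a + c + b + D ∧ z ≤ 5 * a + 5 * (b * h) - 4 * c + D := by
  obtain ⟨i0, hi0⟩ := Finite.exists_min y
  refine ⟨y i0, k - a - ∑ i, (y i - y i0), ∑ i, (y i - y i0), hi0, rfl, by ring, ?_⟩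
  have hD : ((∑ i, (y i - y i0) : ℤ) : ℝ) = ∑ i, ((y i : ℝ) - y i0) := by push_cast; rfl
  have hhR : (1 : ℝ) ≤ h := by exact_mod_cast hh
  obtain ⟨l, p, q, r, t, w, h1, h2, h3, h4, h5, h6, h7, h8, h9, h10, h11, h12, h13, h14, h15⟩ := H
  have hm : (1 : ℝ) ≤ m := by
    exact_mod_cast Fin.pos i0
  have hE : l i0 ≤ m * l i0 := le_mul_of_one_le_left (h1 i0) hm
  have hEh : m * l i0 ≤ m * l i0 * h :=
    le_mul_of_one_le_right ((h1 i0).trans hE) hhR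
  have hsum : ∑ i, ((y i : ℝ) - y i0) = ∑ i, l i - m * l i0 := by
    simp only [h2, add_sub_add_left_eq_sub, Finset.sum_sub_distrib, Finset.sum_const,
      Finset.card_univ, Fintype.card_fin, nsmul_eq_mul]
  have hb : ((k - a - ∑ i, (y i - y i0) : ℤ) : ℝ) = (k - a - ∑ i, l i) + m * l i0 := by
    push_cast [hsum]
    ring
  have hbh : (((k - a - ∑ i, (y i - y i0)) * h : ℤ) : ℝ) =
      (k - a - ∑ i, l i) * h + m * l i0 * h := by
    rw [Int.cast_mul, hb]
    push_cast
    ring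
  have hc := h2 i0
  have hl := h1 i0
  have hB : 0 ≤ (k : ℝ) - a - ∑ i, l i := by linarith
  have hBh : (k : ℝ) - a - ∑ i, l i ≤ (k - a - ∑ i, l i) * h :=
    le_mul_of_one_le_right hB hhR
  generalize hBdef : (k : ℤ) - a - ∑ i, (y i - y i0) = B at *
  generalize hDdef : ∑ i, (y i - y i0) = D at *
  generalize hGdef : B * (h : ℤ) = G at *
  have hD' : (D : ℝ) = ∑ i, l i - m * l i0 := hD.trans hsum
  refine ⟨?_, ?_, ?_, ?_, ?_, ?_, ?_, ?_, ?_, ?_⟩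
  all_goals
    rify
    linarith

lemma mem_semigroup_or_hole [Nonempty (Fin m)] (hh : 1 ≤ h) {a z k : ℤ} {y : Fin m → ℤ}
    (H : InCone h (a : ℝ) (fun i => (y i : ℝ)) z k) :
    hpt (a : ℝ) (fun i => (y i : ℝ)) z k ∈ semigroup (polytopeP h (m + 2)) ∨
      ∃ j ∈ Finset.Icc 1 h, hpt (a : ℝ) (fun i => (y i : ℝ)) z k = holePoint m j := by
  obtain ⟨c, b, D, hcy, hD, hk, ha, hb, hc, h1, h2, h3, h4, h5, h6, h7⟩ := inCone_int hh H
  have hD0 : 0 ≤ D := hD ▸ Finset.sum_nonneg fun i _ => sub_nonneg.2 (hcy i)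
  by_cases hex : a = 1 ∧ b = 1 ∧ 1 ≤ c ∧ c ≤ b * h ∧ D = 0 ∧ z = c + 2
  · right
    obtain ⟨rfl, rfl, hc1, hch, rfl, rfl⟩ := hex
    lift c to ℕ using hc
    refine ⟨c, by rw [Finset.mem_Icc]; omega, ?_⟩
    have hy (i : Fin m) : y i = c := by
      have := (Finset.sum_eq_zero_iff_of_nonneg fun i _ => sub_nonneg.2 (hcy i)).1 hD.symm i
        (Finset.mem_univ i)
      omega
    rw [holePoint, hk]
    congr 1
    · simp
    · funext i; simp [hy]
    · norm_num
  · left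
    obtain ⟨p, q, r, t, w, hpq, hz, g1, g2, g3, g4, g5, g6, g7, g8, g9, g10, g11, g12⟩ :=
      exists_decomposition ha hb (le_mul_of_one_le_right hb (by exact_mod_cast hh))
        (by rintro rfl; simp) hc h1 hD0 h2 h3 h4 h5 h6 h7 hex
    lift b to ℕ using hb
    have := add_mem_semigroup (add_mem_semigroup (facet_mem_semigroup (m := m) hh g1 g2 g5 g6)
      (diagonal_mem_semigroup hh b g3 g4 g7 g8 g9 g10))
      (sum_single_mem_semigroup hh (f := fun i => y i - c) (fun i => sub_nonneg.2 (hcy i))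
        Finset.univ g11 (hD ▸ g12))
    rw [hpt_add, hpt_add, ← hD] at this
    convert this using 1
    congr 1
    · simp
    · funext i
      simp [Finset.sum_apply, Pi.single_apply, hpq]
    · simp [hz]
    · simp [hk]

lemma holes_subset [Nonempty (Fin m)] (hh : 1 ≤ h) :
    holes (polytopeP h (m + 2)) ⊆ holePoint m '' (Finset.Icc 1 h : Set ℕ) := by
  rintro x ⟨⟨hc, hl⟩, hs⟩
  obtain ⟨a, y, z, k, rfl⟩ := exists_eq_hpt x
  obtain ⟨a, y', z, k, rfl, hy, rfl, rfl⟩ := exists_int_of_hpt_mem (lattice_subset _ hl)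
  obtain rfl : y = fun i => (y' i : ℝ) := funext hy
  obtain hmem | ⟨j, hj, he⟩ :=
    mem_semigroup_or_hole hh (hpt_mem_coneSubmodule.1 (cone_subset hh hc))
  · exact absurd hmem hs
  · exact ⟨j, hj, he.symm⟩

lemma holePoint_mem_cone (hh : 1 ≤ h) {j : ℕ} (hj : j ∈ Finset.Icc 1 h) :
    holePoint m j ∈ cone (polytopeP h (m + 2)) := by
  rw [Finset.mem_Icc] at hj
  have sub {x} (hx : x ∈ latticeGens (polytopeP h (m + 2))) :
      x ∈ Submodule.span ℝ≥0 (latticeGens (polytopeP h (m + 2))) := Submodule.subset_span hx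
  have g1 := sub ((IsGen.facet (h := h) (m := m) 0 4 (by omega) (by omega) (by omega)
    (by omega)).mem_latticeGens hh)
  have g2 := sub ((IsGen.facet (h := h) (m := m) 1 1 (by omega) (by omega) (by omega)
    (by omega)).mem_latticeGens hh)
  have g3 := sub ((IsGen.diag (h := h) (m := m) j j (by omega) (by omega) (by omega)
    (by omega) (by omega) (by omega)).mem_latticeGens hh)
  have g4 := sub ((IsGen.diag (h := h) (m := m) (j - 1) (j - 1) (by omega) (by omega) (by omega)
    (by omega) (by omega) (by omega)).mem_latticeGens hh)
  -- The midpoint construction averages the choices `p = 0` and `p = 1`, landing in the gap between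
  -- them.
  have := Submodule.smul_mem _ (1 / 2 : ℝ≥0) (add_mem (add_mem g1 g2) (add_mem g3 g4))
  rw [hpt_add, hpt_add, hpt_add, NNReal.smul_def, smul_hpt] at this
  change holePoint m j ∈ Submodule.span ℝ≥0 (latticeGens (polytopeP h (m + 2)))
  convert this using 1
  rw [holePoint]
  congr 1
  · norm_num
  · funext i
    simp only [Pi.add_apply, Pi.smul_apply, smul_eq_mul]
    push_cast
    ring
  · push_cast
    ring
  · push_cast
    norm_num

lemma holePoint_mem_lattice (hh : 1 ≤ h) {j : ℕ} (hj : j ∈ Finset.Icc 1 h) :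
    holePoint m j ∈ lattice (polytopeP h (m + 2)) := by
  rw [Finset.mem_Icc] at hj
  have sub {x} (hx : x ∈ latticeGens (polytopeP h (m + 2))) :
      x ∈ AddSubgroup.closure (latticeGens (polytopeP h (m + 2))) :=
    AddSubgroup.subset_closure hx
  have g1 := sub ((IsGen.facet (h := h) (m := m) 0 4 (by omega) (by omega) (by omega)
    (by omega)).mem_latticeGens hh)
  have g2 := sub ((IsGen.diag (h := h) (m := m) j (j - 1) (by omega) (by omega) (by omega)
    (by omega) (by omega) (by omega)).mem_latticeGens hh)
  have g3 := sub ((IsGen.diag (h := h) (m := m) 0 0 (by omega) (by omega) (by omega)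
    (by omega) (by omega) (by omega)).mem_latticeGens hh)
  have g4 := sub ((IsGen.diag (h := h) (m := m) 0 1 (by omega) (by omega) (by omega)
    (by omega) (by omega) (by omega)).mem_latticeGens hh)
  -- Subtracting `g4` from `g3` lowers `z` by one without changing the degree.
  have := sub_mem (add_mem (add_mem g1 g2) g3) g4
  change holePoint m j ∈ AddSubgroup.closure (latticeGens (polytopeP h (m + 2)))
  convert this using 1
  rw [eq_sub_iff_add_eq, hpt_add, hpt_add, holePoint, hpt_add]
  congr 1
  · simp
  · funext i
    simp
  · push_cast
    ring
  · norm_num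

lemma InCone.facet_of_degree_one {y : Fin m → ℝ} {z : ℝ} (H : InCone h 1 y z 1) (i : Fin m) :
    0 ≤ y i ∧ y i ≤ 1 ∧ 4 * (1 - y i) ≤ z ∧ z ≤ 4 * (1 - y i) + 1 := by
  obtain ⟨l, p, q, r, t, w, h1, h2, h3, h4, h5, h6, h7, h8, h9, h10, h11, h12, h13, h14, h15⟩ := H
  have hs : 0 ≤ ∑ i, l i := Finset.sum_nonneg fun i _ => h1 i
  have hl : l i ≤ ∑ i, l i := Finset.single_le_sum (fun i _ => h1 i) (Finset.mem_univ i)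
  have hi := h1 i
  have hs0 : ∑ i, l i = 0 := by linarith
  have hz0 : (1 - 1 - ∑ i, l i) * (h : ℝ) = 0 := by simp [hs0]
  rw [h2 i]
  refine ⟨?_, ?_, ?_, ?_⟩ <;> linarith

lemma InCone.strip_of_degree_one {y : Fin m → ℝ} {z : ℝ} (H : InCone h 0 y z 1) (i : Fin m) :
    z ≤ y i + 1 ∧ y i ≤ z + 1 := by
  obtain ⟨l, p, q, r, t, w, h1, h2, h3, h4, h5, h6, h7, h8, h9, h10, h11, h12, h13, h14, h15⟩ := H
  have hl : l i ≤ ∑ i, l i := Finset.single_le_sum (fun i _ => h1 i) (Finset.mem_univ i)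
  have hi := h1 i
  rw [h2 i]
  constructor <;> linarith

lemma InCone.first_mem_Icc {a : ℝ} {y : Fin m → ℝ} {z : ℝ} (H : InCone h a y z 1) :
    0 ≤ a ∧ a ≤ 1 := by
  obtain ⟨l, p, q, r, t, w, h1, h2, h3, h4, h5, h6, h7, h8, h9, h10, h11, h12, h13, h14, h15⟩ := H
  have hs : 0 ≤ ∑ i, l i := Finset.sum_nonneg fun i _ => h1 i
  constructor <;> linarith

/-- In degree 2 there would be two summands, one with first coordinate 1 and one with 0. If the
former has middle coordinate 0, the total last coordinate is at least `j + 3`; if it has 1, the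
total is at most `j + 1`. -/
lemma holePoint_notMem_semigroup [Nonempty (Fin m)] (hh : 1 ≤ h) (j : ℕ) :
    holePoint m j ∉ semigroup (polytopeP h (m + 2)) := by
  intro hmem
  obtain ⟨u, hu, v, hv, he⟩ := exists_add_of_mem_semigroup hmem (hpt_last _ _ _ _)
  obtain ⟨a, y, z, rfl, Hu⟩ := exists_of_mem_latticeGens hh hu
  obtain ⟨a', y', z', rfl, Hv⟩ := exists_of_mem_latticeGens hh hv
  rw [hpt_add, holePoint] at he
  obtain ⟨ha, hy, hz, -⟩ := hpt_inj he
  obtain ⟨i⟩ := ‹Nonempty (Fin m)›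
  replace hy : (j : ℝ) = y i + y' i := congrFun hy i
  have b1 := Hu.first_mem_Icc
  have b2 := Hv.first_mem_Icc
  norm_cast at ha hy hz b1 b2
  rcases (by omega : (a = 1 ∧ a' = 0) ∨ (a = 0 ∧ a' = 1)) with ⟨rfl, rfl⟩ | ⟨rfl, rfl⟩
  · rw [Int.cast_one] at Hu
    rw [Int.cast_zero] at Hv
    have f := Hu.facet_of_degree_one i
    have g := Hv.strip_of_degree_one i
    norm_cast at f g
    rcases (by omega : y i = 0 ∨ y i = 1) with hY | hY <;> rw [hY] at f hy <;> omega
  · rw [Int.cast_zero] at Hu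
    rw [Int.cast_one] at Hv
    have f := Hv.facet_of_degree_one i
    have g := Hu.strip_of_degree_one i
    norm_cast at f g
    rcases (by omega : y' i = 0 ∨ y' i = 1) with hY | hY <;> rw [hY] at f hy <;> omega

lemma holes_polytopeP [Nonempty (Fin m)] (hh : 1 ≤ h) :
    holes (polytopeP h (m + 2)) = holePoint m '' (Finset.Icc 1 h : Set ℕ) := by
  refine (holes_subset hh).antisymm ?_
  rintro _ ⟨j, hj, rfl⟩
  exact ⟨⟨holePoint_mem_cone hh hj, holePoint_mem_lattice hh hj⟩,
    holePoint_notMem_semigroup hh j⟩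

lemma ncard_holes [Nonempty (Fin m)] (hh : 1 ≤ h) :
    (holes (polytopeP h (m + 2))).ncard = h := by
  have hinj : Function.Injective (holePoint m) := by
    intro i j hij
    obtain ⟨-, -, hz, -⟩ := hpt_inj hij
    exact_mod_cast add_right_cancel hz
  rw [holes_polytopeP hh, Set.ncard_image_of_injective _ hinj, Set.ncard_coe_finset,
    Nat.card_Icc, Nat.add_sub_cancel]

end holes

/-! ### Integrality and dimension. -/

section polytope

variable {m : ℕ} {h : ℕ}

lemma isIntegralConvexPolytope_polytopeP (hh : 1 ≤ h) :
    IsIntegralConvexPolytope (polytopeP h (m + 2)) := by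
  refine ⟨⟨_, ?_, rfl⟩, ?_⟩
  · refine Set.Finite.union (by simp [uPoints]) ?_
    have : vPoints (m + 2) ⊆ (fun i => e (m + 2) i) '' (Finset.Icc 2 (m + 2 - 1) : Set ℕ) ∪
        (fun i => e (m + 2) i + e (m + 2) (m + 2)) '' (Finset.Icc 2 (m + 2 - 1) : Set ℕ) := by
      rintro x ⟨i, hi, rfl | rfl⟩
      · exact Or.inl ⟨i, hi, rfl⟩
      · exact Or.inr ⟨i, hi, rfl⟩
    exact (((Finset.finite_toSet _).image _).union ((Finset.finite_toSet _).image _)).subset this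
  · intro x hx
    obtain ⟨a, y, z, -, rfl⟩ := exists_isGen_of_mem hh (extremePoints_convexHull_subset hx)
    exact pt_mem_integerPoints

lemma vectorSpan_polytopeP : vectorSpan ℝ (polytopeP h (m + 2)) = ⊤ := by
  have h0 : pt 0 (fun _ : Fin m => 0) 0 ∈ polytopeP h (m + 2) :=
    uPoints_subset (exists_mem_uPoints _ (by simp))
  rw [← zero_eq_pt] at h0
  have sub {x} (hx : x ∈ polytopeP h (m + 2)) : x ∈ vectorSpan ℝ (polytopeP h (m + 2)) := by
    simpa using vsub_mem_vectorSpan ℝ hx h0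
  have hd : pt 0 (0 : Fin m → ℝ) 1 ∈ vectorSpan ℝ (polytopeP h (m + 2)) :=
    sub (uPoints_subset (exists_mem_uPoints _ (by simp [← Pi.zero_def])))
  have h4 : pt 1 (0 : Fin m → ℝ) 4 ∈ vectorSpan ℝ (polytopeP h (m + 2)) :=
    sub (uPoints_subset (exists_mem_uPoints _ (by simp [← Pi.zero_def])))
  have hi (i : Fin m) : pt 0 (Pi.single i 1) 0 ∈ vectorSpan ℝ (polytopeP h (m + 2)) :=
    sub (vPoints_subset ⟨i + 2, by simp, Or.inl (e_mid i).symm⟩)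
  have hsum (y : Fin m → ℝ) (I : Finset (Fin m)) :
      pt 0 (∑ i ∈ I, Pi.single i (y i)) 0 ∈ vectorSpan ℝ (polytopeP h (m + 2)) := by
    induction I using Finset.induction_on with
    | empty =>
      rw [Finset.sum_empty]
      exact zero_eq_pt (m := m) ▸ zero_mem _
    | insert i I hiI ih =>
      rw [Finset.sum_insert hiI]
      have := add_mem (Submodule.smul_mem _ (y i) (hi i)) ih
      rw [smul_pt, pt_add] at this
      simpa [← Pi.single_smul] using this
  rw [eq_top_iff]
  intro x _
  rw [eq_pt x]
  generalize x 0 = a, (fun i : Fin m => x (Fin.castSucc i.succ)) = y, x (Fin.last _) = z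
  -- The term `-4 * a` cancels the last coordinate of `e_1 + 4 e_d`.
  have := add_mem (add_mem (Submodule.smul_mem _ a h4) (Submodule.smul_mem _ (z - 4 * a) hd))
    (hsum y Finset.univ)
  rw [smul_pt, smul_pt, pt_add, pt_add, Finset.univ_sum_single] at this
  convert this using 2
  · ring
  · simp
  · ring

end polytope

end LatticePolytope

theorem theorem1 (h d : ℕ) (hh : 1 ≤ h) (hd : 3 ≤ d) :
    ∃ P : Set (Fin d → ℝ),
      P = LatticePolytope.polytopeP h d ∧
      LatticePolytope.IsIntegralConvexPolytope P ∧
      LatticePolytope.dim P = d ∧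
      ¬ LatticePolytope.IsNormal P ∧
      LatticePolytope.IsVeryAmple P ∧
      (LatticePolytope.holes P).ncard = h := by
  obtain ⟨m, rfl⟩ : ∃ m, d = m + 2 := ⟨d - 2, by omega⟩
  have : Nonempty (Fin m) := ⟨⟨0, by omega⟩⟩
  have hcard := LatticePolytope.ncard_holes (m := m) hh
  refine ⟨_, rfl, LatticePolytope.isIntegralConvexPolytope_polytopeP hh, ?_, fun hn => ?_, ?_,
    hcard⟩
  · rw [LatticePolytope.dim, LatticePolytope.vectorSpan_polytopeP, finrank_top,
      Module.finrank_fin_fun]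
  · rw [LatticePolytope.holes, hn, Set.sdiff_self, Set.ncard_empty] at hcard
    omega
  -- `Set.ncard` is 0 on infinite sets, so the value `h ≥ 1` already forces finiteness.
  · exact Set.finite_of_ncard_pos (by omega)
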